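/- Let $X$ and $Y$ be complex Banach spaces, let $-A$ be the generator of a bounded strongly continuous semigroup $(T(t))_{t\ge 0}$ on $X$, and assume that $A$ is boundedly invertible, i.e. $0\in\varrho(A)$. Let $C: D(A)\to Y$ be linear and bounded with respect to the graph norm $\|x\|+\|Ax\|$ on $D(A)$. For $\alpha>0$ let $A^{-\alpha}$ denote the (bounded) fractional power of $A$, that is $$A^{-\alpha}x=\frac{\sin \pi\alpha}{\pi}\int_0^\infty t^{-\alpha}(t+A)^{-1}x\,dt\qquad(0<\alpha<1),$$ and $A^{-(n+s)}=(A^{-1})^nA^{-s}$ for $n\in\mathbb N$, $0\le s<1$ (with $A^{0}=I$); it maps $D(A)$ into $D(A)$. If there are $\varepsilon,\delta>0$ such that $$\|CA^{-\frac12-\varepsilon}x\|_Y\ \ge\ \delta\,\|x\|\qquad\text{for all } x\in D(A),$$ then $C$ is infinite-time exactly observable for $A$: there is a constant $m>0$ such that $$m^2\|x\|^2\ \le\ \int_0^\infty\|CT(t)x\|_Y^2\,dt\qquad\text{for all } x\in D(A),$$ where the right-hand side may be $+\infty$. -/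

import Mathlib

open Filter Topology MeasureTheory Set
open scoped NNReal ENNReal

/-- A strongly continuous one-parameter semigroup of bounded operators on `X`. -/
structure C0Semigroup (X : Type*) [NormedAddCommGroup X] [NormedSpace ℂ X] where
  toFun : ℝ≥0 → X →L[ℂ] X
  map_zero : toFun 0 = ContinuousLinearMap.id ℂ X
  map_add : ∀ s t : ℝ≥0, toFun (s + t) = (toFun s).comp (toFun t)
  continuous_orbit : ∀ x : X, Continuous fun t : ℝ≥0 => toFun t x

namespace C0Semigroup

variable {X : Type*} [NormedAddCommGroup X] [NormedSpace ℂ X]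

/-- The semigroup is uniformly bounded: `sup_{t ≥ 0} ‖T t‖ < ∞`. -/
def IsBounded (T : C0Semigroup X) : Prop :=
  ∃ M : ℝ, ∀ t : ℝ≥0, ‖T.toFun t‖ ≤ M

/-- The unbounded operator `B` is the (infinitesimal) generator of `T`: its graph consists exactly
of the pairs `(x, y)` with `y = lim_{t → 0+} (T t x - x) / t`. In particular the domain of `B` is
the set of all `x` for which this limit exists. -/
def IsGenerator (T : C0Semigroup X) (B : X →ₗ.[ℂ] X) : Prop :=
  ∀ x y : X, (x, y) ∈ B.graph ↔
    Tendsto (fun t : ℝ≥0 => (t : ℝ)⁻¹ • (T.toFun t x - x)) (𝓝[>] 0) (𝓝 y)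

theorem IsGenerator.map_mem_domain {T : C0Semigroup X} {A : X →ₗ.[ℂ] X}
    (hA : T.IsGenerator (-A)) (t : ℝ≥0) (x : A.domain) : T.toFun t (x : X) ∈ A.domain := by
  have h1 : ((x : X), (-A) x) ∈ (-A).graph := (-A).mem_graph x
  have h2 := ((T.toFun t).continuous.tendsto _).comp ((hA _ _).1 h1)
  have h3 : (T.toFun t (x : X), T.toFun t ((-A) x)) ∈ (-A).graph := by
    refine (hA _ _).2 (h2.congr fun s => ?_)
    have h4 : T.toFun t (T.toFun s (x : X)) = T.toFun s (T.toFun t (x : X)) := by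
      have h5 := T.map_add t s
      rw [add_comm, T.map_add s t] at h5
      exact (DFunLike.congr_fun h5 (x : X)).symm
    have h6 : ∀ (r : ℝ) (z : X), T.toFun t (r • z) = r • T.toFun t z := fun r z =>
      ((T.toFun t).restrictScalars ℝ).map_smul r z
    simp only [Function.comp_apply, h6, map_sub, h4]
  have h7 : T.toFun t (x : X) ∈ (-A).domain := LinearPMap.mem_domain_of_mem_graph h3
  exact h7

/-- If `-A` generates `T`, each `T t` maps the domain of `A` into itself; this is the resulting
element of the domain. -/
def onDomain {T : C0Semigroup X} {A : X →ₗ.[ℂ] X} (hA : T.IsGenerator (-A)) (t : ℝ≥0)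
    (x : A.domain) : A.domain :=
  ⟨T.toFun t (x : X), hA.map_mem_domain t x⟩

end C0Semigroup

section Operators

variable {X : Type*} [NormedAddCommGroup X] [NormedSpace ℂ X]

/-- `R` is a bounded, everywhere defined, two-sided inverse of the unbounded operator `B`. -/
def IsBoundedInverse (B : X →ₗ.[ℂ] X) (R : X →L[ℂ] X) : Prop :=
  (∀ x : B.domain, R (B x) = x) ∧ ∀ y : X, ∃ h : R y ∈ B.domain, B ⟨R y, h⟩ = y

/-- `B` is boundedly invertible, i.e. `0` lies in its resolvent set. -/
def IsBoundedlyInvertible (B : X →ₗ.[ℂ] X) : Prop :=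
  ∃ R : X →L[ℂ] X, IsBoundedInverse B R

open Classical in
/-- The bounded inverse of `B` (which is unique); `0` if `B` is not boundedly invertible. -/
noncomputable def boundedInverse (B : X →ₗ.[ℂ] X) : X →L[ℂ] X :=
  if h : IsBoundedlyInvertible B then h.choose else 0

/-- The operator `t + A` with domain that of `A`. -/
noncomputable def shift (A : X →ₗ.[ℂ] X) (t : ℝ) : X →ₗ.[ℂ] X :=
  ((t : ℂ) • (LinearMap.id : X →ₗ[ℂ] X)) +ᵥ A

/-- Balakrishnan's formula for `A^{-s} x`, where `0 < s < 1`: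
`A^{-s} x = (sin (π s) / π) ∫_0^∞ t^{-s} (t + A)⁻¹ x dt`. -/
noncomputable def balakrishnan (A : X →ₗ.[ℂ] X) (s : ℝ) (x : X) : X :=
  (Real.sin (Real.pi * s) / Real.pi) •
    ∫ t in Ioi (0 : ℝ), (t ^ (-s)) • boundedInverse (shift A t) x

open Classical in
/-- The fractional power `A^{-α} x`, `α ≥ 0`, of a boundedly invertible operator `A` such that `-A`
generates a bounded semigroup: `A^{-α} = (A⁻¹)^n A^{-s}` where `α = n + s` with `n ∈ ℕ` and
`s ∈ [0, 1)`, and `A^{-s}` is the identity for `s = 0` and given by Balakrishnan's formula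
for `0 < s < 1`. -/
noncomputable def negPow (A : X →ₗ.[ℂ] X) (α : ℝ) (x : X) : X :=
  (boundedInverse A ^ ⌊α⌋₊) (if Int.fract α = 0 then x else balakrishnan A (Int.fract α) x)

variable {Y : Type*} [NormedAddCommGroup Y] [NormedSpace ℂ Y]

/-- `C : D(A) → Y` is bounded with respect to the graph norm `‖x‖ + ‖A x‖`. -/
def IsGraphBounded (A : X →ₗ.[ℂ] X) (C : A.domain →ₗ[ℂ] Y) : Prop :=
  ∃ K : ℝ, ∀ x : A.domain, ‖C x‖ ≤ K * (‖(x : X)‖ + ‖A x‖)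

/-- Infinite-time exact (`L²`-)observability: there is `m > 0` with
`m² ‖x‖² ≤ ∫_0^∞ ‖C T(t) x‖² dt` (possibly `= ∞`) for all `x ∈ D(A)`. -/
def IsInfiniteTimeExactlyObservable {T : C0Semigroup X} {A : X →ₗ.[ℂ] X}
    (hA : T.IsGenerator (-A)) (C : A.domain →ₗ[ℂ] Y) : Prop :=
  ∃ m : ℝ, 0 < m ∧ ∀ x : A.domain,
    ENNReal.ofReal (m ^ 2 * ‖(x : X)‖ ^ 2) ≤
      ∫⁻ t in Ioi (0 : ℝ), ‖C (C0Semigroup.onDomain hA t.toNNReal x)‖ₑ ^ 2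

end Operators

/-! Put `F = C A⁻¹`, a bounded operator, and `w = A x`; the output energy is then `v² = ∫ ‖F T(t)
w‖² dt`. Since `(r + A)⁻¹` is the Laplace transform of the semigroup, Cauchy–Schwarz gives `‖F (r +
A)⁻¹ w‖ ≤ r ^ (-1/2) v`. Inserted into Balakrishnan's integral, this bound converges at infinity for
exponents above 1/2 but then diverges at 0.

The cure is to replace `x` by `Q ^ n x`, where `P = (1 + A)⁻¹` and `Q = 1 - P = A P`. The resolvent
identity gives `(r + A)⁻¹ Q = P - r (r + A)⁻¹ P`, which removes the singularity at 0, and `P` does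
not increase the energy. Hence `‖F A^{-α} Q ^ n w‖ ≤ K v` for every `α > 1/2`
(`exists_norm_negPow_le`). The hypothesis at `Q ^ n x = A⁻¹ Q ^ n w` yields `δ ‖Q ^ n x‖ ≤ K v`.
Nothing is lost in passing to `Q ^ n x`, because `Q` has the bounded inverse `1 + A⁻¹`
(`one_add_pow_mul_pow_sub`). -/

/-! ### Resolvent algebra. -/

section InverseAlgebra

variable {X : Type*} [NormedAddCommGroup X] [NormedSpace ℂ X]

theorem shift_zero (A : X →ₗ.[ℂ] X) : shift A 0 = A := by
  simp [shift]

theorem shift_apply (A : X →ₗ.[ℂ] X) (r : ℝ) (x : X) (h : x ∈ (shift A r).domain)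
    (h' : x ∈ A.domain) : shift A r ⟨x, h⟩ = (r : ℂ) • x + A ⟨x, h'⟩ := rfl

/-- The resolvent identity. -/
theorem IsBoundedInverse.sub_eq {A : X →ₗ.[ℂ] X} {r q : ℝ} {R S : X →L[ℂ] X}
    (hR : IsBoundedInverse (shift A r) R) (hS : IsBoundedInverse (shift A q) S) :
    R - S = ((q : ℂ) - r) • (R * S) := by
  ext y
  obtain ⟨h, hy⟩ := hS.2 y
  have h' : S y ∈ A.domain := h
  rw [shift_apply A q _ h h'] at hy
  have h1 := hR.1 ⟨S y, h'⟩
  rw [shift_apply A r _ h' h'] at h1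
  have h2 : (r : ℂ) • S y + A ⟨S y, h'⟩ = y - ((q : ℂ) - r) • S y := by
    nth_rewrite 3 [← hy]
    module
  rw [h2, map_sub, map_smul] at h1
  change R y - S y = ((q : ℂ) - r) • R (S y)
  rw [sub_eq_iff_eq_add, add_comm, ← sub_eq_iff_eq_add]
  exact h1

theorem IsBoundedInverse.unique {A : X →ₗ.[ℂ] X} {r : ℝ} {R S : X →L[ℂ] X}
    (hR : IsBoundedInverse (shift A r) R) (hS : IsBoundedInverse (shift A r) S) : R = S := by
  have := hR.sub_eq hS
  simpa [sub_eq_zero] using this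

theorem IsBoundedInverse.commute {A : X →ₗ.[ℂ] X} {r q : ℝ} {R S : X →L[ℂ] X}
    (hR : IsBoundedInverse (shift A r) R) (hS : IsBoundedInverse (shift A q) S) :
    Commute R S := by
  rcases eq_or_ne q r with rfl | hne
  · rw [hR.unique hS]
  · have h1 := hR.sub_eq hS
    have h2 := hS.sub_eq hR
    have h3 : ((q : ℂ) - r) • (R * S) = ((q : ℂ) - r) • (S * R) := by
      rw [← h1, ← neg_sub S R, h2, ← neg_smul, neg_sub]
    have h4 : (q : ℂ) - r ≠ 0 := sub_ne_zero.2 (by exact_mod_cast hne)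
    exact smul_right_injective _ h4 h3

theorem IsBoundedlyInvertible.isBoundedInverse {B : X →ₗ.[ℂ] X} (h : IsBoundedlyInvertible B) :
    IsBoundedInverse B (boundedInverse B) := by
  rw [boundedInverse, dif_pos h]
  exact h.choose_spec

theorem IsBoundedlyInvertible.isBoundedInverse_shift_zero {A : X →ₗ.[ℂ] X}
    (hinv : IsBoundedlyInvertible A) : IsBoundedInverse (shift A 0) (boundedInverse A) := by
  rw [shift_zero]
  exact hinv.isBoundedInverse

theorem IsBoundedInverse.boundedInverse_eq {A : X →ₗ.[ℂ] X} {r : ℝ} {R : X →L[ℂ] X}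
    (hR : IsBoundedInverse (shift A r) R) : boundedInverse (shift A r) = R :=
  (IsBoundedlyInvertible.isBoundedInverse ⟨R, hR⟩).unique hR

end InverseAlgebra

/-! ### The resolvent as a Laplace transform. -/

namespace C0Semigroup

variable {X : Type*} [NormedAddCommGroup X] [NormedSpace ℂ X]

/-- The semigroup with real time parameter, constant for negative times. -/
def op (T : C0Semigroup X) (t : ℝ) : X →L[ℂ] X := T.toFun t.toNNReal

variable (T : C0Semigroup X)

theorem continuous_op (w : X) : Continuous fun t => T.op t w :=
  (T.continuous_orbit w).comp continuous_real_toNNReal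

theorem op_zero (w : X) : T.op 0 w = w := by
  simp [op, T.map_zero]

theorem op_add {s t : ℝ} (hs : 0 ≤ s) (ht : 0 ≤ t) (w : X) :
    T.op s (T.op t w) = T.op (t + s) w := by
  simp [op, add_comm t s, Real.toNNReal_add hs ht, T.map_add]

theorem continuous_exp_smul_op (r : ℝ) (w : X) :
    Continuous fun t : ℝ => Real.exp (-r * t) • T.op t w :=
  (by fun_prop : Continuous fun t : ℝ => Real.exp (-r * t)).smul (T.continuous_op w)

theorem norm_exp_smul_op_le {M : ℝ} (hM : ∀ t, ‖T.toFun t‖ ≤ M) (r t : ℝ) (w : X) :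
    ‖Real.exp (-r * t) • T.op t w‖ ≤ Real.exp (-r * t) * (M * ‖w‖) := by
  rw [norm_smul, Real.norm_of_nonneg (Real.exp_nonneg _)]
  gcongr
  exact (T.op t).le_of_opNorm_le (hM _) w

theorem integrableOn_exp_smul_op {M : ℝ} (hM : ∀ t, ‖T.toFun t‖ ≤ M) {r : ℝ} (hr : 0 < r)
    (w : X) : IntegrableOn (fun t : ℝ => Real.exp (-r * t) • T.op t w) (Ioi 0) :=
  Integrable.mono' ((integrableOn_exp_mul_Ioi (neg_lt_zero.2 hr) 0).mul_const (M * ‖w‖))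
    (T.continuous_exp_smul_op r w).aestronglyMeasurable
    (ae_of_all _ fun t => T.norm_exp_smul_op_le hM r t w)

theorem exists_laplace {M : ℝ} (hM : ∀ t, ‖T.toFun t‖ ≤ M) {r : ℝ} (hr : 0 < r) :
    ∃ R : X →L[ℂ] X, (∀ w, R w = ∫ t in Ioi (0 : ℝ), Real.exp (-r * t) • T.op t w) ∧
      ‖R‖ ≤ M / r := by
  have hM0 : 0 ≤ M := (norm_nonneg _).trans (hM 0)
  let L : X →ₗ[ℂ] X :=
    { toFun := fun w => ∫ t in Ioi (0 : ℝ), Real.exp (-r * t) • T.op t w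
      map_add' := fun v w => by
        simp only [_root_.map_add, smul_add]
        exact integral_add (T.integrableOn_exp_smul_op hM hr v)
          (T.integrableOn_exp_smul_op hM hr w)
      map_smul' := fun c w => by
        simp only [map_smul, RingHom.id_apply]
        rw [← integral_smul]
        simp only [smul_comm c] }
  have hL : ∀ w, ‖L w‖ ≤ M / r * ‖w‖ := fun w => by
    refine (norm_integral_le_of_norm_le
      ((integrableOn_exp_mul_Ioi (neg_lt_zero.2 hr) 0).mul_const (M * ‖w‖))
      (ae_of_all _ fun t => T.norm_exp_smul_op_le hM r t w)).trans_eq ?_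
    rw [integral_mul_const, integral_exp_mul_Ioi (neg_lt_zero.2 hr)]
    simp
    ring
  exact ⟨L.mkContinuous _ hL, fun w => rfl, L.mkContinuous_norm_le (by positivity) hL⟩

theorem op_laplace [CompleteSpace X] {M : ℝ} (hM : ∀ t, ‖T.toFun t‖ ≤ M) {r : ℝ} (hr : 0 < r)
    {h : ℝ} (hh : 0 ≤ h) (w : X) :
    T.op h (∫ t in Ioi (0 : ℝ), Real.exp (-r * t) • T.op t w) =
      Real.exp (r * h) • ((∫ t in Ioi (0 : ℝ), Real.exp (-r * t) • T.op t w) -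
        ∫ t in (0 : ℝ)..h, Real.exp (-r * t) • T.op t w) := by
  have hi := T.integrableOn_exp_smul_op hM hr w
  have h1 : (∫ t in Ioi (0 : ℝ), Real.exp (-r * t) • T.op t w) -
        ∫ t in (0 : ℝ)..h, Real.exp (-r * t) • T.op t w =
      ∫ t in Ioi h, Real.exp (-r * t) • T.op t w := by
    rw [sub_eq_iff_eq_add', intervalIntegral.integral_interval_add_Ioi hi
      (hi.mono_set (Ioi_subset_Ioi hh))]
  rw [h1, ← ContinuousLinearMap.integral_comp_comm _ hi, ← integral_smul,
    ← (measurePreserving_add_right volume h).setIntegral_preimage_emb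
      (measurableEmbedding_addRight h) _ (Ioi h), preimage_add_const_Ioi, sub_self]
  refine setIntegral_congr_fun measurableSet_Ioi fun t (ht : 0 < t) => ?_
  simp only [ContinuousLinearMap.map_smul_of_tower, T.op_add hh ht.le, smul_smul, ← Real.exp_add]
  congr 2
  ring

/-- With `v` the Laplace transform of `w`, the function is the orbit of `v` for `h ≥ 0` by
`op_laplace`, so its derivative is the generator's value at `v`. -/
theorem hasDerivAt_laplace [CompleteSpace X] (r : ℝ) (v w : X) :
    HasDerivAt (fun h => Real.exp (r * h) •
      (v - ∫ t in (0 : ℝ)..h, Real.exp (-r * t) • T.op t w)) (r • v - w) 0 := by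
  have h1 : HasDerivAt (fun h => ∫ t in (0 : ℝ)..h, Real.exp (-r * t) • T.op t w)
      (Real.exp (-r * 0) • T.op 0 w) 0 :=
    intervalIntegral.integral_hasDerivAt_right (by simp)
      ((T.continuous_exp_smul_op r w).stronglyMeasurableAtFilter _ _)
      (T.continuous_exp_smul_op r w).continuousAt
  have h2 : HasDerivAt (fun h => Real.exp (r * h)) (Real.exp (r * 0) * (r * 1)) 0 :=
    ((hasDerivAt_id (0 : ℝ)).const_mul r).exp
  exact (h2.smul (h1.const_sub v)).congr_deriv (by simp [T.op_zero, neg_add_eq_sub])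

variable {T} {A : X →ₗ.[ℂ] X}

theorem IsGenerator.mem_graph_of_hasDerivAt (hA : T.IsGenerator (-A)) {x y : X} {f : ℝ → X}
    (hf : HasDerivAt f y 0) (hfx : ∀ h, 0 ≤ h → f h = T.op h x) : (x, y) ∈ (-A).graph := by
  have hc : Tendsto (fun t : ℝ≥0 => (t : ℝ)) (𝓝[>] 0) (𝓝[>] 0) :=
    tendsto_nhdsWithin_iff.2 ⟨by
      simpa using (NNReal.continuous_coe.tendsto 0).mono_left nhdsWithin_le_nhds,
      eventually_mem_nhdsWithin.mono fun t ht => by simpa using ht⟩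
  refine (hA x y).2 ((hf.tendsto_slope_zero_right.comp hc).congr fun t => ?_)
  simp [hfx, op, T.map_zero]

theorem exists_apply_eq_neg_of_mem_graph {x y : X} (h : (x, y) ∈ (-A).graph) :
    ∃ hx : x ∈ A.domain, A ⟨x, hx⟩ = -y := by
  have hx : x ∈ (-A).domain := LinearPMap.mem_domain_of_mem_graph h
  refine ⟨hx, ?_⟩
  have h1 := (LinearPMap.mem_graph_iff _).1 h
  obtain ⟨z, hz, hzy⟩ := h1
  have : z = ⟨x, hx⟩ := Subtype.ext hz
  subst this
  simp only at hzy
  rw [← hzy, LinearPMap.neg_apply, neg_neg]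

theorem IsGenerator.op_apply (hA : T.IsGenerator (-A)) (t : ℝ) (x : A.domain) :
    ∃ h : T.op t x ∈ A.domain, A ⟨T.op t x, h⟩ = T.op t (A x) := by
  have h1 : ((x : X), (-A) x) ∈ (-A).graph := (-A).mem_graph x
  have h2 := ((T.op t).continuous.tendsto _).comp ((hA _ _).1 h1)
  have h3 : (T.op t (x : X), T.op t ((-A) x)) ∈ (-A).graph := by
    refine (hA _ _).2 (h2.congr fun s => ?_)
    have h4 : T.op t (T.toFun s (x : X)) = T.toFun s (T.op t (x : X)) := by
      rw [op, ← ContinuousLinearMap.comp_apply, ← T.map_add, add_comm, T.map_add,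
        ContinuousLinearMap.comp_apply]
    simp only [Function.comp_apply, ContinuousLinearMap.map_smul_of_tower, map_sub, h4]
  obtain ⟨h, h5⟩ := exists_apply_eq_neg_of_mem_graph h3
  refine ⟨h, h5.trans ?_⟩
  rw [LinearPMap.neg_apply, map_neg, neg_neg]

theorem IsGenerator.op_boundedInverse (hA : T.IsGenerator (-A)) {r : ℝ} {R : X →L[ℂ] X}
    (hR : IsBoundedInverse (shift A r) R) (t : ℝ) (w : X) : T.op t (R w) = R (T.op t w) := by
  obtain ⟨h, hw⟩ := hR.2 w
  obtain ⟨h', h1⟩ := hA.op_apply t ⟨R w, h⟩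
  rw [shift_apply A r _ h h] at hw
  have h2 := hR.1 ⟨T.op t (R w), h'⟩
  rw [shift_apply A r _ h' h', h1, ← map_smul, ← _root_.map_add] at h2
  exact (h2.symm.trans (congrArg (fun z => R (T.op t z)) hw))

/-- Every positive number lies in the resolvent set of the negative generator of a bounded
semigroup, and the resolvent is the Laplace transform of the semigroup. -/
theorem IsGenerator.isBoundedInverse_shift [CompleteSpace X] (hA : T.IsGenerator (-A)) {M : ℝ}
    (hM : ∀ t, ‖T.toFun t‖ ≤ M) {r : ℝ} (hr : 0 < r) :
    IsBoundedInverse (shift A r) (boundedInverse (shift A r)) ∧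
      (∀ w, boundedInverse (shift A r) w =
        ∫ t in Ioi (0 : ℝ), Real.exp (-r * t) • T.op t w) ∧
      ‖boundedInverse (shift A r)‖ ≤ M / r := by
  obtain ⟨R, hR, hRM⟩ := T.exists_laplace hM hr
  have key : ∀ w, (R w, r • R w - w) ∈ (-A).graph := fun w =>
    hA.mem_graph_of_hasDerivAt (T.hasDerivAt_laplace r (R w) w) fun h hh => by
      rw [hR, T.op_laplace hM hr hh]
  have hsurj : ∀ y, ∃ h : R y ∈ (shift A r).domain, shift A r ⟨R y, h⟩ = y := fun y => by
    obtain ⟨h, hy⟩ := exists_apply_eq_neg_of_mem_graph (key y)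
    refine ⟨h, ?_⟩
    rw [shift_apply A r _ h h, hy]
    simp
  have hcomm : ∀ (t : ℝ≥0) w, R (T.toFun t w) = T.toFun t (R w) := fun t w => by
    have h1 : T.toFun t = T.op t := by simp [op]
    rw [hR, hR, h1, ← ContinuousLinearMap.integral_comp_comm _
      (T.integrableOn_exp_smul_op hM hr w)]
    refine setIntegral_congr_fun measurableSet_Ioi fun s (hs : 0 < s) => ?_
    simp only [ContinuousLinearMap.map_smul_of_tower, T.op_add hs.le t.coe_nonneg,
      T.op_add t.coe_nonneg hs.le, add_comm s]
  have hinv : IsBoundedInverse (shift A r) R := by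
    refine ⟨fun x => ?_, hsurj⟩
    have hx : (x : X) ∈ A.domain := x.2
    have h1 : ((x : X), (-A) ⟨x, hx⟩) ∈ (-A).graph := (-A).mem_graph ⟨x, hx⟩
    have h2 := (R.continuous.tendsto _).comp ((hA _ _).1 h1)
    have h3 := (hA _ _).1 (key x)
    -- `R` commutes with the semigroup, so it carries the difference quotients at `x` to those at `R
    -- x`; comparing limits gives `-R (A x) = r R x - x`.
    have h4 := tendsto_nhds_unique (h2.congr fun t => by
      simp only [Function.comp_apply, ContinuousLinearMap.map_smul_of_tower, map_sub, hcomm]) h3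
    have h5 : shift A r x = (r : ℂ) • (x : X) + A ⟨x, hx⟩ := rfl
    rw [LinearPMap.neg_apply, map_neg, neg_eq_iff_eq_neg] at h4
    rw [h5, _root_.map_add, map_smul, h4]
    simp
  rw [hinv.boundedInverse_eq]
  exact ⟨hinv, hR, hRM⟩

end C0Semigroup

/-! ### Cauchy–Schwarz and integrals with power weights. -/

section Auxiliary

theorem sq_lintegral_mul_le {α : Type*} [MeasurableSpace α] {μ : Measure α} {f g : α → ℝ≥0∞}
    (hf : AEMeasurable f μ) (hg : AEMeasurable g μ) :
    (∫⁻ a, f a * g a ∂μ) ^ 2 ≤ (∫⁻ a, f a ^ 2 ∂μ) * ∫⁻ a, g a ^ 2 ∂μ := by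
  have h := ENNReal.lintegral_mul_le_Lp_mul_Lq μ Real.HolderConjugate.two_two hf hg
  simp only [Pi.mul_apply, ENNReal.rpow_two] at h
  refine (pow_le_pow_left' h 2).trans_eq ?_
  rw [mul_pow, ← ENNReal.rpow_natCast, ← ENNReal.rpow_natCast, ← ENNReal.rpow_mul,
    ← ENNReal.rpow_mul]
  norm_num

theorem lintegral_exp_neg_mul_Ioi {r : ℝ} (hr : 0 < r) :
    ∫⁻ t in Ioi (0 : ℝ), ENNReal.ofReal (Real.exp (-r * t)) = ENNReal.ofReal r⁻¹ := by
  rw [← ofReal_integral_eq_lintegral_ofReal (integrableOn_exp_mul_Ioi (neg_lt_zero.2 hr) 0)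
    (ae_of_all _ fun t => Real.exp_nonneg _), integral_exp_mul_Ioi (neg_lt_zero.2 hr)]
  simp

/-- Near 0 the bound `1` is used and `s < 1` suffices; at infinity the exponent is `-s - β < -1`. -/
theorem integrableOn_rpow_mul_min {s β : ℝ} (hs : s < 1) (hβ : 1 < s + β) :
    IntegrableOn (fun r : ℝ => r ^ (-s) * min 1 (r ^ (-β))) (Ioi 0) := by
  have hm : ∀ S : Set ℝ, AEStronglyMeasurable (fun r : ℝ => r ^ (-s) * min 1 (r ^ (-β)))
      (volume.restrict S) := fun S => by
    have : Measurable fun r : ℝ => r ^ (-s) * min 1 (r ^ (-β)) := by fun_prop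
    exact this.aestronglyMeasurable
  rw [← Ioc_union_Ioi_eq_Ioi zero_le_one]
  refine IntegrableOn.union ?_ ?_
  · have h1 : IntegrableOn (fun r : ℝ => r ^ (-s)) (Ioc 0 1) :=
      (intervalIntegrable_iff_integrableOn_Ioc_of_le zero_le_one).1
        (intervalIntegral.intervalIntegrable_rpow' (by linarith))
    refine Integrable.mono' h1 (hm _) ((ae_restrict_mem measurableSet_Ioc).mono fun r hr => ?_)
    have h2 : 0 ≤ r ^ (-s) := Real.rpow_nonneg hr.1.le _
    rw [Real.norm_of_nonneg (mul_nonneg h2 (le_min zero_le_one (Real.rpow_nonneg hr.1.le _)))]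
    exact mul_le_of_le_one_right h2 (min_le_left _ _)
  · have h1 : IntegrableOn (fun r : ℝ => r ^ (-s - β)) (Ioi 1) :=
      integrableOn_Ioi_rpow_of_lt (by linarith) one_pos
    refine Integrable.mono' h1 (hm _) ((ae_restrict_mem measurableSet_Ioi).mono fun r hr => ?_)
    have hr0 : 0 < r := zero_lt_one.trans hr
    have h2 : 0 ≤ r ^ (-s) := Real.rpow_nonneg hr0.le _
    rw [Real.norm_of_nonneg (mul_nonneg h2 (le_min zero_le_one (Real.rpow_nonneg hr0.le _))),
      sub_eq_add_neg, Real.rpow_add hr0]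
    exact mul_le_mul_of_nonneg_left (min_le_right _ _) h2

variable {E : Type*} [NormedAddCommGroup E] [NormedSpace ℝ E]

theorem norm_rpow_smul_le {s β c r : ℝ} (hr : 0 < r) {G : ℝ → E}
    (hG : ‖G r‖ ≤ c * min 1 (r ^ (-β))) :
    ‖r ^ (-s) • G r‖ ≤ c * (r ^ (-s) * min 1 (r ^ (-β))) := by
  have h := Real.rpow_nonneg hr.le (-s)
  rw [norm_smul, Real.norm_of_nonneg h, mul_left_comm]
  exact mul_le_mul_of_nonneg_left hG h

theorem integrableOn_rpow_smul {s β c : ℝ} (hs : s < 1) (hβ : 1 < s + β) {G : ℝ → E}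
    (hc : ContinuousOn G (Ioi 0)) (hG : ∀ r, 0 < r → ‖G r‖ ≤ c * min 1 (r ^ (-β))) :
    IntegrableOn (fun r : ℝ => r ^ (-s) • G r) (Ioi 0) := by
  refine Integrable.mono' ((integrableOn_rpow_mul_min hs hβ).const_mul c) ?_
    ((ae_restrict_mem measurableSet_Ioi).mono fun r hr => norm_rpow_smul_le hr (hG r hr))
  refine ContinuousOn.aestronglyMeasurable (ContinuousOn.smul (fun r hr => ?_) hc)
    measurableSet_Ioi
  exact (Real.continuousAt_rpow_const r _ (Or.inl (ne_of_gt hr))).continuousWithinAt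

theorem norm_integral_rpow_smul_le {s β c : ℝ} (hs : s < 1) (hβ : 1 < s + β) {G : ℝ → E}
    (hG : ∀ r, 0 < r → ‖G r‖ ≤ c * min 1 (r ^ (-β))) :
    ‖∫ r in Ioi (0 : ℝ), r ^ (-s) • G r‖ ≤
      c * ∫ r in Ioi (0 : ℝ), r ^ (-s) * min 1 (r ^ (-β)) := by
  rw [← integral_const_mul]
  exact norm_integral_le_of_norm_le ((integrableOn_rpow_mul_min hs hβ).const_mul c)
    ((ae_restrict_mem measurableSet_Ioi).mono fun r hr => norm_rpow_smul_le hr (hG r hr))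

end Auxiliary

/-! ### The output energy. -/

namespace C0Semigroup

variable {X Y : Type*} [NormedAddCommGroup X] [NormedSpace ℂ X]
  [NormedAddCommGroup Y] [NormedSpace ℂ Y]

/-- The output energy `∫_0^∞ ‖F T(t) w‖² dt` of a bounded observation `F`. -/
noncomputable def energy (T : C0Semigroup X) (F : X →L[ℂ] Y) (w : X) : ℝ≥0∞ :=
  ∫⁻ t in Ioi (0 : ℝ), ‖F (T.op t w)‖ₑ ^ 2

theorem continuous_output (T : C0Semigroup X) (F : X →L[ℂ] Y) (w : X) :
    Continuous fun t => ‖F (T.op t w)‖ₑ :=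
  (F.continuous.comp (T.continuous_op w)).enorm

theorem energy_sub_le (T : C0Semigroup X) (F : X →L[ℂ] Y) (v w : X) :
    T.energy F (v - w) ≤ 2 * (T.energy F v + T.energy F w) := by
  rw [energy, energy, energy, ← lintegral_add_left ((T.continuous_output F v).measurable.pow_const 2),
    ← lintegral_const_mul' _ _ (by simp)]
  refine lintegral_mono fun t => ?_
  rw [map_sub, map_sub, ← ofReal_norm, ← ofReal_norm, ← ofReal_norm,
    ← ENNReal.ofReal_pow (norm_nonneg _), ← ENNReal.ofReal_pow (norm_nonneg _),
    ← ENNReal.ofReal_pow (norm_nonneg _), ← ENNReal.ofReal_add (by positivity) (by positivity),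
    ← ENNReal.ofReal_ofNat 2, ← ENNReal.ofReal_mul (by positivity)]
  refine ENNReal.ofReal_le_ofReal ?_
  have h := norm_sub_le (F (T.op t v)) (F (T.op t w))
  nlinarith [norm_nonneg (F (T.op t v) - F (T.op t w)),
    sq_nonneg (‖F (T.op t v)‖ - ‖F (T.op t w)‖)]

variable {T : C0Semigroup X} {A : X →ₗ.[ℂ] X} [CompleteSpace X] [CompleteSpace Y]

theorem IsGenerator.enorm_boundedInverse_shift_le (hA : T.IsGenerator (-A)) {M : ℝ}
    (hM : ∀ t, ‖T.toFun t‖ ≤ M) (F : X →L[ℂ] Y) {r : ℝ} (hr : 0 < r) (w : X) :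
    ‖F (boundedInverse (shift A r) w)‖ₑ ≤
      ∫⁻ t in Ioi (0 : ℝ), ENNReal.ofReal (Real.exp (-r * t)) * ‖F (T.op t w)‖ₑ := by
  rw [(hA.isBoundedInverse_shift hM hr).2.1,
    ← ContinuousLinearMap.integral_comp_comm _ (T.integrableOn_exp_smul_op hM hr w)]
  refine (enorm_integral_le_lintegral_enorm _).trans_eq (lintegral_congr fun t => ?_)
  rw [ContinuousLinearMap.map_smul_of_tower, enorm_smul,
    Real.enorm_of_nonneg (Real.exp_nonneg _)]

theorem IsGenerator.sq_enorm_boundedInverse_shift_le (hA : T.IsGenerator (-A)) {M : ℝ}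
    (hM : ∀ t, ‖T.toFun t‖ ≤ M) (F : X →L[ℂ] Y) {r : ℝ} (hr : 0 < r) (w : X) :
    ‖F (boundedInverse (shift A r) w)‖ₑ ^ 2 ≤ ENNReal.ofReal r⁻¹ * T.energy F w := by
  refine (pow_le_pow_left' (hA.enorm_boundedInverse_shift_le hM F hr w) 2).trans
    ((sq_lintegral_mul_le (by fun_prop) (T.continuous_output F w).aemeasurable).trans ?_)
  refine mul_le_mul_left ?_ _
  -- The square of `exp (-r t)` is bounded by `exp (-r t)` itself, giving `1 / r` instead of the
  -- sharp `1 / (2 r)`.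
  rw [← lintegral_exp_neg_mul_Ioi hr]
  refine setLIntegral_mono' measurableSet_Ioi fun t (ht : 0 < t) => ?_
  rw [← ENNReal.ofReal_pow (Real.exp_nonneg _)]
  refine ENNReal.ofReal_le_ofReal (pow_le_of_le_one (Real.exp_nonneg _) ?_ two_ne_zero)
  rw [Real.exp_le_one_iff]
  nlinarith

/-- `(1 + A)⁻¹` averages `T(u)` against the probability density `exp (-u)`, and translating by `u`
only discards an initial piece of the output. The square is moved inside the average by
Cauchy–Schwarz, with the density split as `k ^ 2`. -/
theorem IsGenerator.energy_boundedInverse_shift_one_le (hA : T.IsGenerator (-A)) {M : ℝ}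
    (hM : ∀ t, ‖T.toFun t‖ ≤ M) (F : X →L[ℂ] Y) (w : X) :
    T.energy F (boundedInverse (shift A 1) w) ≤ T.energy F w := by
  have hJ := (hA.isBoundedInverse_shift hM one_pos).1
  let e : ℝ → ℝ≥0∞ := fun u => ENNReal.ofReal (Real.exp (-1 * u))
  have he : Measurable e := by fun_prop
  have he1 : ∫⁻ u in Ioi (0 : ℝ), e u = 1 := by simpa [e] using lintegral_exp_neg_mul_Ioi one_pos
  let k : ℝ → ℝ≥0∞ := fun u => ENNReal.ofReal (Real.exp (-(1 / 2) * u))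
  have hk : Measurable k := by fun_prop
  have hke : ∀ u, k u ^ 2 = e u := fun u => by
    simp only [k, e]
    rw [← ENNReal.ofReal_pow (Real.exp_nonneg _), ← Real.exp_nat_mul]
    congr 2
    push_cast
    ring
  let g : ℝ → ℝ≥0∞ := fun t => ‖F (T.op t w)‖ₑ
  have hg : Measurable g := (T.continuous_output F w).measurable
  have h1 : ∀ t ∈ Ioi (0 : ℝ), ‖F (T.op t (boundedInverse (shift A 1) w))‖ₑ ^ 2 ≤
      ∫⁻ u in Ioi (0 : ℝ), e u * g (t + u) ^ 2 := fun t (ht : 0 < t) => by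
    rw [hA.op_boundedInverse hJ]
    have h2 : ‖F (boundedInverse (shift A 1) (T.op t w))‖ₑ ≤
        ∫⁻ u in Ioi (0 : ℝ), k u * (k u * g (t + u)) := by
      refine (hA.enorm_boundedInverse_shift_le hM F one_pos _).trans_eq
        (setLIntegral_congr_fun measurableSet_Ioi fun u (hu : 0 < u) => ?_)
      simp only [T.op_add hu.le ht.le, g]
      rw [← mul_assoc, ← sq, hke]
    refine (pow_le_pow_left' h2 2).trans ((sq_lintegral_mul_le (by fun_prop)
      (by fun_prop)).trans_eq ?_)
    simp only [mul_pow, hke, he1, one_mul]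
  calc T.energy F (boundedInverse (shift A 1) w)
      ≤ ∫⁻ t in Ioi (0 : ℝ), ∫⁻ u in Ioi (0 : ℝ), e u * g (t + u) ^ 2 :=
        setLIntegral_mono' measurableSet_Ioi h1
    _ = ∫⁻ u in Ioi (0 : ℝ), ∫⁻ t in Ioi (0 : ℝ), e u * g (t + u) ^ 2 :=
        lintegral_lintegral_swap (by
          apply Measurable.aemeasurable
          simp only [Function.uncurry_def]
          fun_prop)
    _ ≤ ∫⁻ u in Ioi (0 : ℝ), e u * T.energy F w := by
        refine setLIntegral_mono' measurableSet_Ioi fun u (hu : 0 < u) => ?_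
        rw [lintegral_const_mul _ (by fun_prop)]
        refine mul_le_mul_right ?_ _
        have h3 := (measurePreserving_add_right volume u).setLIntegral_comp_preimage_emb
          (measurableEmbedding_addRight u) (fun t => g t ^ 2) (Ioi u)
        rw [preimage_add_const_Ioi, sub_self] at h3
        rw [h3]
        exact lintegral_mono_set (Ioi_subset_Ioi hu.le)
    _ = T.energy F w := by rw [lintegral_mul_const _ he, he1, one_mul]

end C0Semigroup

/-! ### Resolvent bounds and observed fractional powers. -/

namespace C0Semigroup

variable {X Y : Type*} [NormedAddCommGroup X] [NormedSpace ℂ X] [CompleteSpace X]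
  [NormedAddCommGroup Y] [NormedSpace ℂ Y] [CompleteSpace Y]
  {T : C0Semigroup X} {A : X →ₗ.[ℂ] X} {M : ℝ}

/-- The decay is the Laplace bound `M / r`; boundedness near 0 comes from `J = R - r R J`, where
that same bound cancels the factor `r`. -/
theorem IsGenerator.exists_norm_boundedInverse_shift_le (hA : T.IsGenerator (-A))
    (hM : ∀ t, ‖T.toFun t‖ ≤ M) (hinv : IsBoundedlyInvertible A) :
    ∃ c : ℝ, 0 ≤ c ∧ ∀ r, 0 < r →
      ‖boundedInverse (shift A r)‖ ≤ c * min 1 (r ^ (-1 : ℝ)) := by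
  have hM0 : 0 ≤ M := (norm_nonneg _).trans (hM 0)
  refine ⟨‖boundedInverse A‖ * (1 + M) + M, by positivity, fun r hr => ?_⟩
  obtain ⟨hJ, -, hJM⟩ := hA.isBoundedInverse_shift hM hr
  set J := boundedInverse (shift A r)
  set R := boundedInverse A
  have h1 := hinv.isBoundedInverse_shift_zero.sub_eq hJ
  have h2 : J = R - (r : ℂ) • (R * J) := by
    rw [eq_sub_iff_add_eq, ← eq_sub_iff_add_eq']
    simpa using h1.symm
  have h3 : ‖J‖ ≤ ‖R‖ * (1 + M) := by
    calc ‖J‖ = ‖R - (r : ℂ) • (R * J)‖ := congrArg _ h2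
      _ ≤ ‖R‖ + r * (‖R‖ * (M / r)) := by
        refine (norm_sub_le _ _).trans ?_
        rw [norm_smul, Complex.norm_real, Real.norm_of_nonneg hr.le]
        gcongr
        exact (norm_mul_le _ _).trans (by gcongr)
      _ = ‖R‖ * (1 + M) := by field_simp
  rw [Real.rpow_neg_one, mul_min_of_nonneg _ _ (by positivity), le_min_iff]
  constructor
  · linarith
  · refine hJM.trans ?_
    rw [div_eq_mul_inv]
    gcongr
    have : 0 ≤ ‖R‖ * (1 + M) := by positivity
    linarith

theorem IsGenerator.continuousOn_boundedInverse_shift (hA : T.IsGenerator (-A))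
    (hM : ∀ t, ‖T.toFun t‖ ≤ M) (hinv : IsBoundedlyInvertible A) (w : X) :
    ContinuousOn (fun r => boundedInverse (shift A r) w) (Ioi 0) := by
  obtain ⟨c, hc, hJ⟩ := hA.exists_norm_boundedInverse_shift_le hM hinv
  have hJc : ∀ r, 0 < r → ‖boundedInverse (shift A r)‖ ≤ c := fun r hr =>
    (hJ r hr).trans (mul_le_of_le_one_right hc (min_le_left _ _))
  have hlip : LipschitzOnWith (c * c).toNNReal (fun r => boundedInverse (shift A r)) (Ioi 0) := by
    refine LipschitzOnWith.of_dist_le_mul fun r hr q hq => ?_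
    rw [dist_eq_norm, (hA.isBoundedInverse_shift hM hr).1.sub_eq
      (hA.isBoundedInverse_shift hM hq).1, norm_smul, mul_comm, dist_comm, Real.dist_eq,
      ← Complex.ofReal_sub, Complex.norm_real, Real.norm_eq_abs, Real.coe_toNNReal _ (by positivity)]
    gcongr
    exact (norm_mul_le _ _).trans (mul_le_mul (hJc r hr) (hJc q hq) (norm_nonneg _) hc)
  exact hlip.continuousOn.clm_apply continuousOn_const

theorem IsGenerator.integrableOn_balakrishnan (hA : T.IsGenerator (-A))
    (hM : ∀ t, ‖T.toFun t‖ ≤ M) (hinv : IsBoundedlyInvertible A) {s : ℝ} (hs0 : 0 < s)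
    (hs : s < 1) (w : X) :
    IntegrableOn (fun r : ℝ => r ^ (-s) • boundedInverse (shift A r) w) (Ioi 0) := by
  obtain ⟨c, hc, hJ⟩ := hA.exists_norm_boundedInverse_shift_le hM hinv
  refine integrableOn_rpow_smul (β := 1) (c := c * ‖w‖) hs (by linarith)
    (hA.continuousOn_boundedInverse_shift hM hinv w) fun r hr => ?_
  refine ((boundedInverse (shift A r)).le_of_opNorm_le (hJ r hr) w).trans_eq ?_
  ring

/-- This keeps `A^{-α}` inside the domain and turns `C A^{-α} A⁻¹` into `F A^{-α}`. -/
theorem IsGenerator.negPow_boundedInverse (hA : T.IsGenerator (-A))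
    (hM : ∀ t, ‖T.toFun t‖ ≤ M) (hinv : IsBoundedlyInvertible A) (α : ℝ) (w : X) :
    negPow A α (boundedInverse A w) = boundedInverse A (negPow A α w) := by
  have hpow : ∀ z, (boundedInverse A ^ ⌊α⌋₊) (boundedInverse A z) =
      boundedInverse A ((boundedInverse A ^ ⌊α⌋₊) z) := fun z =>
    DFunLike.congr_fun ((Commute.refl (boundedInverse A)).pow_left ⌊α⌋₊).eq z
  unfold negPow
  rw [← hpow]
  congr 1
  split_ifs with h
  · rfl
  · have hs0 : 0 < Int.fract α := (Int.fract_nonneg α).lt_of_ne' h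
    rw [balakrishnan, balakrishnan, ContinuousLinearMap.map_smul_of_tower,
      ← ContinuousLinearMap.integral_comp_comm _
        (hA.integrableOn_balakrishnan hM hinv hs0 (Int.fract_lt_one α) w)]
    congr 1
    refine setIntegral_congr_fun measurableSet_Ioi fun r hr => ?_
    simp only [ContinuousLinearMap.map_smul_of_tower]
    congr 1
    exact DFunLike.congr_fun (((hA.isBoundedInverse_shift hM hr).1.commute
      hinv.isBoundedInverse_shift_zero).eq) w

/-- If the output energy of `w` is at most `v²`, then that of `w - (1 + A)⁻¹ w` is at most
`(2 v)²`. -/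
theorem IsGenerator.energy_sub_boundedInverse_le (hA : T.IsGenerator (-A))
    (hM : ∀ t, ‖T.toFun t‖ ≤ M) (F : X →L[ℂ] Y) {w : X} {v : ℝ}
    (hv : T.energy F w ≤ ENNReal.ofReal (v ^ 2)) :
    T.energy F ((1 - boundedInverse (shift A 1)) w) ≤ ENNReal.ofReal ((2 * v) ^ 2) := by
  have h := T.energy_sub_le F w (boundedInverse (shift A 1) w)
  refine h.trans ?_
  calc 2 * (T.energy F w + T.energy F (boundedInverse (shift A 1) w))
      ≤ 2 * (ENNReal.ofReal (v ^ 2) + ENNReal.ofReal (v ^ 2)) := by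
        gcongr
        exact (hA.energy_boundedInverse_shift_one_le hM F w).trans hv
    _ = ENNReal.ofReal ((2 * v) ^ 2) := by
        rw [← ENNReal.ofReal_add (by positivity) (by positivity), ← ENNReal.ofReal_ofNat 2,
          ← ENNReal.ofReal_mul (by positivity)]
        ring_nf

theorem IsGenerator.energy_pow_le (hA : T.IsGenerator (-A))
    (hM : ∀ t, ‖T.toFun t‖ ≤ M) (F : X →L[ℂ] Y) (k : ℕ) (w : X) :
    T.energy F ((boundedInverse (shift A 1) ^ k) w) ≤ T.energy F w := by
  induction k with
  | zero => simp
  | succ k ih =>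
    rw [pow_succ']
    exact (hA.energy_boundedInverse_shift_one_le hM F _).trans ih

theorem IsGenerator.norm_boundedInverse_shift_le (hA : T.IsGenerator (-A))
    (hM : ∀ t, ‖T.toFun t‖ ≤ M) (F : X →L[ℂ] Y) {w : X} {v : ℝ} (hv0 : 0 ≤ v)
    (hv : T.energy F w ≤ ENNReal.ofReal (v ^ 2)) {r : ℝ} (hr : 0 < r) :
    ‖F (boundedInverse (shift A r) w)‖ ≤ r ^ (-(1 / 2) : ℝ) * v := by
  have h := (hA.sq_enorm_boundedInverse_shift_le hM F hr w).trans (mul_le_mul_right hv _)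
  rw [← ofReal_norm, ← ENNReal.ofReal_pow (norm_nonneg _),
    ← ENNReal.ofReal_mul (by positivity), ENNReal.ofReal_le_ofReal_iff (by positivity)] at h
  refine le_of_sq_le_sq ?_ (by positivity)
  rw [mul_pow, ← Real.rpow_natCast (r ^ _), ← Real.rpow_mul hr.le]
  norm_num [Real.rpow_neg_one]
  exact h

theorem IsGenerator.boundedInverse_shift_mul_sub (hA : T.IsGenerator (-A))
    (hM : ∀ t, ‖T.toFun t‖ ≤ M) {r : ℝ} (hr : 0 < r) (w : X) :
    boundedInverse (shift A r) ((1 - boundedInverse (shift A 1)) w) =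
      boundedInverse (shift A 1) w -
        r • boundedInverse (shift A r) (boundedInverse (shift A 1) w) := by
  have h := DFunLike.congr_fun ((hA.isBoundedInverse_shift hM hr).1.sub_eq
    (hA.isBoundedInverse_shift hM one_pos).1) w
  change boundedInverse (shift A r) w - boundedInverse (shift A 1) w =
    (((1 : ℝ) : ℂ) - r) • boundedInverse (shift A r) (boundedInverse (shift A 1) w) at h
  change boundedInverse (shift A r) (w - boundedInverse (shift A 1) w) = _
  rw [map_sub, sub_eq_iff_eq_add, sub_eq_iff_eq_add.1 h]
  rw [← Complex.coe_smul, Complex.ofReal_one]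
  module

/-- The observed resolvent of `w - P w`, `P = (1 + A)⁻¹`, is bounded near `0` and decays like
`r ^ (-1/2)`. -/
theorem IsGenerator.norm_shift_sub_le (hA : T.IsGenerator (-A))
    (hM : ∀ t, ‖T.toFun t‖ ≤ M) (F : X →L[ℂ] Y) {w : X} {v : ℝ} (hv0 : 0 ≤ v)
    (hv : T.energy F w ≤ ENNReal.ofReal (v ^ 2)) {r : ℝ} (hr : 0 < r) :
    ‖F (boundedInverse (shift A r) ((1 - boundedInverse (shift A 1)) w))‖ ≤
      2 * v * min 1 (r ^ (-(1 / 2) : ℝ)) := by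
  have hP := (hA.energy_boundedInverse_shift_one_le hM F w).trans hv
  rw [mul_min_of_nonneg _ _ (by positivity), le_min_iff]
  constructor
  -- For `r ≤ 1` the identity for `(r + A)⁻¹ Q` brings a factor `r` that absorbs `r ^ (-1/2)`; for
  -- `r ≥ 1` the plain decay bound is already at most `2 v`.
  · rcases le_total r 1 with h1 | h1
    · rw [hA.boundedInverse_shift_mul_sub hM hr, map_sub, ContinuousLinearMap.map_smul_of_tower]
      refine (norm_sub_le _ _).trans ?_
      have h2 := hA.norm_boundedInverse_shift_le hM F hv0 hv one_pos
      have h3 := hA.norm_boundedInverse_shift_le hM F hv0 hP hr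
      rw [Real.one_rpow, one_mul] at h2
      rw [norm_smul, Real.norm_of_nonneg hr.le]
      have h4 : r * r ^ (-(1 / 2) : ℝ) ≤ 1 := by
        rw [← Real.rpow_one_add' hr.le (by norm_num)]
        exact Real.rpow_le_one hr.le h1 (by norm_num)
      have h5 := mul_le_mul_of_nonneg_left h3 hr.le
      have h6 := mul_le_mul_of_nonneg_right h4 hv0
      nlinarith
    · have h2 := hA.norm_boundedInverse_shift_le hM F (by positivity)
        (hA.energy_sub_boundedInverse_le hM F hv) hr
      have h3 : r ^ (-(1 / 2) : ℝ) ≤ 1 := Real.rpow_le_one_of_one_le_of_nonpos h1 (by norm_num)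
      have h4 := mul_le_mul_of_nonneg_right h3 (by positivity : 0 ≤ 2 * v)
      linarith
  · have h2 := hA.norm_boundedInverse_shift_le hM F (by positivity)
      (hA.energy_sub_boundedInverse_le hM F hv) hr
    linarith

/-- An extra factor `P` improves the decay to `1 / r`: from `r (r + A)⁻¹ P Q w = P Q w - (r + A)⁻¹
Q² w`, the observed terms on the right are at most `2 v` and `4 v`, uniformly in `r`. -/
theorem IsGenerator.norm_shift_sub_boundedInverse_le (hA : T.IsGenerator (-A))
    (hM : ∀ t, ‖T.toFun t‖ ≤ M) (F : X →L[ℂ] Y) {w : X} {v : ℝ} (hv0 : 0 ≤ v)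
    (hv : T.energy F w ≤ ENNReal.ofReal (v ^ 2)) {r : ℝ} (hr : 0 < r) :
    ‖F (boundedInverse (shift A r) ((1 - boundedInverse (shift A 1))
      (boundedInverse (shift A 1) w)))‖ ≤ 6 * v * min 1 (r ^ (-1 : ℝ)) := by
  have hP := (hA.energy_boundedInverse_shift_one_le hM F w).trans hv
  have hQ := hA.energy_sub_boundedInverse_le hM F hv
  rw [mul_min_of_nonneg _ _ (by positivity), le_min_iff]
  constructor
  · refine (hA.norm_shift_sub_le hM F hv0 hP hr).trans ?_
    nlinarith [min_le_left 1 (r ^ (-(1 / 2) : ℝ))]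
  · have h1 := hA.boundedInverse_shift_mul_sub hM hr ((1 - boundedInverse (shift A 1)) w)
    have hcomm : boundedInverse (shift A 1) ((1 - boundedInverse (shift A 1)) w) =
        (1 - boundedInverse (shift A 1)) (boundedInverse (shift A 1) w) :=
      DFunLike.congr_fun ((Commute.one_right (boundedInverse (shift A 1))).sub_right
        (Commute.refl _)).eq w
    rw [hcomm, eq_sub_iff_add_eq, ← eq_sub_iff_add_eq'] at h1
    have h2 := congrArg (fun z => ‖F z‖) h1
    simp only [ContinuousLinearMap.map_smul_of_tower, map_sub F, norm_smul,
      Real.norm_of_nonneg hr.le] at h2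
    have h3 := hA.norm_boundedInverse_shift_le hM F (by positivity) hQ one_pos
    rw [hcomm, Real.one_rpow, one_mul] at h3
    have h4 := hA.norm_shift_sub_le hM F (by positivity) hQ hr
    have h5 := norm_sub_le (F ((1 - boundedInverse (shift A 1)) (boundedInverse (shift A 1) w)))
      (F (boundedInverse (shift A r) ((1 - boundedInverse (shift A 1))
        ((1 - boundedInverse (shift A 1)) w))))
    rw [← h2] at h5
    rw [Real.rpow_neg_one, ← div_eq_mul_inv, le_div_iff₀' hr]
    nlinarith [min_le_left 1 (r ^ (-(1 / 2) : ℝ))]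

theorem IsGenerator.boundedInverse_mul_sub (hA : T.IsGenerator (-A))
    (hM : ∀ t, ‖T.toFun t‖ ≤ M) (hinv : IsBoundedlyInvertible A) :
    boundedInverse A * (1 - boundedInverse (shift A 1)) = boundedInverse (shift A 1) := by
  have h := hinv.isBoundedInverse_shift_zero.sub_eq (hA.isBoundedInverse_shift hM one_pos).1
  simp only [Complex.ofReal_one, Complex.ofReal_zero, sub_zero, one_smul] at h
  rw [mul_sub, mul_one, ← h, sub_sub_cancel]

theorem IsGenerator.commute_sub (hA : T.IsGenerator (-A))
    (hM : ∀ t, ‖T.toFun t‖ ≤ M) (hinv : IsBoundedlyInvertible A) :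
    Commute (boundedInverse A) (1 - boundedInverse (shift A 1)) :=
  (Commute.one_right _).sub_right
    (hinv.isBoundedInverse_shift_zero.commute (hA.isBoundedInverse_shift hM one_pos).1)

/-- Each `A⁻¹` pairs with one `Q` to give `P`; the additional `Q` is kept to tame the resolvent near
0. -/
theorem IsGenerator.pow_mul_pow_sub (hA : T.IsGenerator (-A))
    (hM : ∀ t, ‖T.toFun t‖ ≤ M) (hinv : IsBoundedlyInvertible A) (k : ℕ) :
    boundedInverse A ^ k * (1 - boundedInverse (shift A 1)) ^ (k + 1) =
      (1 - boundedInverse (shift A 1)) * boundedInverse (shift A 1) ^ k := by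
  rw [pow_succ, ← mul_assoc, ← (hA.commute_sub hM hinv).mul_pow, hA.boundedInverse_mul_sub hM hinv]
  exact (((Commute.one_right _).sub_right (Commute.refl _)).pow_left k).eq

theorem IsGenerator.one_add_pow_mul_pow_sub (hA : T.IsGenerator (-A))
    (hM : ∀ t, ‖T.toFun t‖ ≤ M) (hinv : IsBoundedlyInvertible A) (k : ℕ) :
    (1 + boundedInverse A) ^ k * (1 - boundedInverse (shift A 1)) ^ k = 1 := by
  rw [← ((Commute.one_left _).add_left (hA.commute_sub hM hinv)).mul_pow, add_mul, one_mul,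
    hA.boundedInverse_mul_sub hM hinv, sub_add_cancel, one_pow]

/-- The bounded observation `F` composed with `A^{-α} (A (1 + A)⁻¹)^n`, for a suitable `n`, is
dominated by the square root of the output energy as soon as `α > 1/2`. -/
theorem IsGenerator.exists_norm_negPow_le (hA : T.IsGenerator (-A))
    (hM : ∀ t, ‖T.toFun t‖ ≤ M) (hinv : IsBoundedlyInvertible A) (F : X →L[ℂ] Y) {α : ℝ}
    (hα : 1 / 2 < α) :
    ∃ K : ℝ, ∀ (w : X) (v : ℝ), 0 ≤ v → T.energy F w ≤ ENNReal.ofReal (v ^ 2) →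
      ‖F (negPow A α (((1 - boundedInverse (shift A 1)) ^ (⌊α⌋₊ + 1)) w))‖ ≤ K * v := by
  have hfl : α = ⌊α⌋₊ + Int.fract α := by
    rw [natCast_floor_eq_intCast_floor (by linarith), Int.floor_add_fract]
  set k := ⌊α⌋₊ with hk
  set s := Int.fract α with hs
  set P := boundedInverse (shift A 1) with hP
  by_cases hs0 : s = 0
  -- An integer exponent above 1/2 is at least 1, so one `P` is available as the resolvent at `r =
  -- 1`.
  · obtain ⟨j, hj⟩ : ∃ j, k = j + 1 := Nat.exists_eq_succ_of_ne_zero fun h0 => by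
      rw [h0, hs0] at hfl
      norm_num at hfl
      linarith
    refine ⟨2, fun w v hv0 hv => ?_⟩
    have h1 : negPow A α (((1 - P) ^ (k + 1)) w) = (P * ((1 - P) * P ^ j)) w := by
      rw [negPow, if_pos hs0, ← hk, ← mul_apply_eq_comp,
        hA.pow_mul_pow_sub hM hinv, hj, pow_succ', ← mul_assoc, ← mul_assoc]
      have : Commute P (1 - P) := (Commute.one_right _).sub_right (Commute.refl _)
      rw [this.eq]
    rw [h1]
    have h2 := hA.norm_boundedInverse_shift_le hM F (by positivity)
      (hA.energy_sub_boundedInverse_le hM F ((hA.energy_pow_le hM F j w).trans hv)) one_pos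
    rwa [Real.one_rpow, one_mul] at h2
  · have hs0' : 0 < s := (Int.fract_nonneg α).lt_of_ne' hs0
    have hs1 : s < 1 := Int.fract_lt_one α
    have h1 : ∀ w, F (negPow A α (((1 - P) ^ (k + 1)) w)) = (Real.sin (Real.pi * s) / Real.pi) •
        ∫ r in Ioi (0 : ℝ), r ^ (-s) • F (boundedInverse (shift A r) ((1 - P) ((P ^ k) w))) := by
      intro w
      rw [negPow, if_neg hs0, ← hk, ← hs, balakrishnan, ← ContinuousLinearMap.comp_apply,
        ContinuousLinearMap.map_smul_of_tower, ← ContinuousLinearMap.integral_comp_comm _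
        (hA.integrableOn_balakrishnan hM hinv hs0' hs1 _)]
      congr 1
      refine setIntegral_congr_fun measurableSet_Ioi fun r hr => ?_
      simp only [ContinuousLinearMap.map_smul_of_tower, ContinuousLinearMap.comp_apply]
      congr 2
      have hc := ((hinv.isBoundedInverse_shift_zero.commute
        (hA.isBoundedInverse_shift hM hr).1).pow_left k).eq
      have h2 : boundedInverse A ^ k * (boundedInverse (shift A r) * (1 - P) ^ (k + 1)) =
          boundedInverse (shift A r) * ((1 - P) * P ^ k) := by
        rw [← mul_assoc, hc, mul_assoc, hA.pow_mul_pow_sub hM hinv]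
      exact DFunLike.congr_fun h2 w
    obtain ⟨β, c, hβ, hc⟩ : ∃ β c : ℝ, 1 < s + β ∧ ∀ (w : X) (v : ℝ), 0 ≤ v →
        T.energy F w ≤ ENNReal.ofReal (v ^ 2) → ∀ r, 0 < r →
        ‖F (boundedInverse (shift A r) ((1 - P) ((P ^ k) w)))‖ ≤
          c * v * min 1 (r ^ (-β)) := by
      -- If `k = 0`, then `s = α > 1/2` and decay `r ^ (-1/2)` is enough. If `k ≥ 1`, `s` may be
      -- arbitrarily small, and a spare `P` supplies decay `1 / r`.
      rcases Nat.eq_zero_or_eq_succ_pred k with h0 | hj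
      · refine ⟨1 / 2, 2, ?_, fun w v hv0 hv r hr => ?_⟩
        · rw [h0] at hfl
          norm_num at hfl
          linarith
        · rw [h0, pow_zero]
          exact hA.norm_shift_sub_le hM F hv0 hv hr
      · refine ⟨1, 6, by linarith, fun w v hv0 hv r hr => ?_⟩
        rw [hj, Nat.succ_eq_add_one, pow_succ']
        exact hA.norm_shift_sub_boundedInverse_le hM F hv0
          ((hA.energy_pow_le hM F _ w).trans hv) hr
    refine ⟨|Real.sin (Real.pi * s) / Real.pi| *
      (c * ∫ r in Ioi (0 : ℝ), r ^ (-s) * min 1 (r ^ (-β))), fun w v hv0 hv => ?_⟩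
    rw [h1, norm_smul, Real.norm_eq_abs, mul_assoc]
    gcongr
    refine (norm_integral_rpow_smul_le hs1 hβ (hc w v hv0 hv)).trans_eq ?_
    ring

end C0Semigroup

/-! ### The observability estimate. -/

theorem mainTheorem10 {X Y : Type*} [NormedAddCommGroup X] [NormedSpace ℂ X] [CompleteSpace X]
    [NormedAddCommGroup Y] [NormedSpace ℂ Y] [CompleteSpace Y]
    (T : C0Semigroup X) (hT : T.IsBounded)
    (A : X →ₗ.[ℂ] X) (hA : T.IsGenerator (-A)) (hinv : IsBoundedlyInvertible A)
    (C : A.domain →ₗ[ℂ] Y) (hC : IsGraphBounded A C)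
    (ε δ : ℝ) (hε : 0 < ε) (hδ : 0 < δ)
    (hlow : ∀ (x : A.domain) (h : negPow A (1 / 2 + ε) x ∈ A.domain),
      δ * ‖(x : X)‖ ≤ ‖C ⟨negPow A (1 / 2 + ε) x, h⟩‖) :
    IsInfiniteTimeExactlyObservable hA C := by
  obtain ⟨M, hM⟩ := hT
  obtain ⟨κ, hκ⟩ := hC
  have hR := hinv.isBoundedInverse
  have hmem : ∀ w, boundedInverse A w ∈ A.domain := fun w => (hR.2 w).1
  have hAR : ∀ w, A ⟨boundedInverse A w, hmem w⟩ = w := fun w => (hR.2 w).2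
  obtain ⟨F, hF⟩ : ∃ F : X →L[ℂ] Y, ∀ w (h : boundedInverse A w ∈ A.domain),
      F w = C ⟨boundedInverse A w, h⟩ := by
    let L : X →ₗ[ℂ] Y := C ∘ₗ LinearMap.codRestrict A.domain (boundedInverse A : X →ₗ[ℂ] X) hmem
    refine ⟨L.mkContinuous (|κ| * (‖boundedInverse A‖ + 1)) fun w => ?_, fun w h => rfl⟩
    have h1 : ‖L w‖ ≤ κ * (‖boundedInverse A w‖ + ‖A ⟨boundedInverse A w, hmem w⟩‖) := hκ _
    rw [hAR] at h1
    refine h1.trans ?_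
    rw [mul_assoc, add_mul, one_mul]
    gcongr
    · exact le_abs_self κ
    · exact (boundedInverse A).le_opNorm w
  obtain ⟨K, hK⟩ := hA.exists_norm_negPow_le hM hinv F (α := 1 / 2 + ε) (by linarith)
  set n := ⌊1 / 2 + ε⌋₊ + 1
  set Q := 1 - boundedInverse (shift A 1)
  set D := ‖(1 + boundedInverse A) ^ n‖
  -- The bounds `δ ‖Q ^ n x‖ ≤ K v` and `‖x‖ ≤ D ‖Q ^ n x‖` suggest `δ / (D K)`; enlarging both
  -- factors keeps the denominator positive.
  refine ⟨δ / ((D + 1) * (|K| + 1)), by positivity, fun x => ?_⟩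
  set w := A x
  have hx : (x : X) = boundedInverse A w := (hR.1 x).symm
  have hE : ∫⁻ t in Ioi (0 : ℝ), ‖C (C0Semigroup.onDomain hA t.toNNReal x)‖ₑ ^ 2 =
      T.energy F w := by
    refine lintegral_congr fun t => ?_
    have h1 : T.toFun t.toNNReal x = boundedInverse A (T.op t w) := by
      rw [← hA.op_boundedInverse hinv.isBoundedInverse_shift_zero, ← hx]
      rfl
    rw [hF _ (hmem _)]
    congr 4
    exact Subtype.ext h1
  rw [hE]
  by_cases htop : T.energy F w = ⊤
  · rw [htop]
    exact le_top
  set v := √(T.energy F w).toReal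
  have hv : T.energy F w = ENNReal.ofReal (v ^ 2) := by
    rw [Real.sq_sqrt ENNReal.toReal_nonneg, ENNReal.ofReal_toReal htop]
  rw [hv, ← mul_pow]
  have hv0 : 0 ≤ v := Real.sqrt_nonneg _
  refine ENNReal.ofReal_le_ofReal (pow_le_pow_left₀ (by positivity) ?_ 2)
  have hQx : (Q ^ n) (x : X) = boundedInverse A ((Q ^ n) w) := by
    rw [hx]
    exact (DFunLike.congr_fun ((hA.commute_sub hM hinv).pow_right n).eq w).symm
  -- The lower bound is applied at `Q ^ n x`, not at `x`.
  have h1 : δ * ‖(Q ^ n) (x : X)‖ ≤ K * v := by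
    have hm : negPow A (1 / 2 + ε) (boundedInverse A ((Q ^ n) w)) ∈ A.domain := by
      rw [hA.negPow_boundedInverse hM hinv]
      exact hmem _
    have h2 := hlow ⟨boundedInverse A ((Q ^ n) w), hmem _⟩ hm
    have h3 : C ⟨negPow A (1 / 2 + ε) (boundedInverse A ((Q ^ n) w)), hm⟩ =
        F (negPow A (1 / 2 + ε) ((Q ^ n) w)) := by
      rw [hF _ (hmem _)]
      congr 1
      exact Subtype.ext (hA.negPow_boundedInverse hM hinv _ _)
    rw [hQx]
    refine h2.trans ?_
    rw [h3]
    exact hK w v hv0 hv.le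
  have h2 : ‖(x : X)‖ ≤ D * ‖(Q ^ n) (x : X)‖ := by
    have h3 := DFunLike.congr_fun (hA.one_add_pow_mul_pow_sub hM hinv n) (x : X)
    calc ‖(x : X)‖ = ‖((1 + boundedInverse A) ^ n) ((Q ^ n) (x : X))‖ := congrArg norm h3.symm
      _ ≤ _ := ContinuousLinearMap.le_opNorm _ _
  have hD : 0 ≤ D := norm_nonneg _
  rw [div_mul_eq_mul_div, div_le_iff₀ (by positivity)]
  calc δ * ‖(x : X)‖ ≤ δ * (D * ‖(Q ^ n) (x : X)‖) := by gcongr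
    _ = D * (δ * ‖(Q ^ n) (x : X)‖) := by ring
    _ ≤ D * (K * v) := by gcongr
    _ ≤ (D + 1) * ((|K| + 1) * v) := by
        refine mul_le_mul (by linarith) ?_ ((by positivity : (0 : ℝ) ≤ _).trans h1) (by positivity)
        gcongr
        linarith [le_abs_self K]
    _ = v * ((D + 1) * (|K| + 1)) := by ring
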